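/- Theorem 4.2. Let $N,T$ be natural numbers (the degenerate case $N=0$ or $T=0$ is allowed), let $a>0$, let $B_a$ be the open ball of radius $a$ centered at $0$ in Euclidean $\mathbb{R}^N$, and let $\mathbb{R}^N\times\mathbb{R}^N$ carry its usual inner product $\langle\!\langle\cdot|\cdot\rangle\!\rangle$. Assume: $(H_\Phi)$ $\phi:B_a\to\mathbb{R}^N$ is a homeomorphism onto $\mathbb{R}^N$ with $\phi(0)=0$ and $\phi=\nabla\Phi$ on $B_a$, where $\Phi:\overline{B}_a\to\mathbb{R}$ is of class $C^1$ on $B_a$, continuous and strictly convex on $\overline{B}_a$, and $\Phi(0)=0$; $(H_F)$ $F:\{1,\dots,T\}\times\mathbb{R}^N\to\mathbb{R}$ is continuous, $\nabla_uF$ exists and is continuous on $\{1,\dots,T\}\times\mathbb{R}^N$, and $F(n,0)=0$ for all $n$; $(H_j)$ $j:\mathbb{R}^N\times\mathbb{R}^N\to(-\infty,+\infty]$ is proper, convex and lower semicontinuous, with $j(0,0)=0$ and $(0,0)\in\partial j(0,0)$, where $\partial j(z)=\{p: j(z')\ge j(z)+\langle\!\langle p|z'-z\rangle\!\rangle\ \text{for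 all } z'\}$. Let $X$ be the space of functions $u:\{0,\dots,T+1\}\to\mathbb{R}^N$ with inner product $(u|v)=\sum_{n=0}^{T+1}\langle u(n)|v(n)\rangle$; put $\Delta u(n)=u(n+1)-u(n)$ and $\|\Delta u\|_\infty=\max_{0\le n\le T}|\Delta u(n)|$. Define $\Psi,J:X\to(-\infty,+\infty]$ and $\mathbf{F}:X\to\mathbb{R}$ by $$\Psi(u)=\begin{cases}\sum_{n=0}^{T}\Phi(\Delta u(n)),&\|\Delta u\|_\infty\le a,\\ +\infty,&\text{otherwise},\end{cases}\qquad J(u)=j(u(0),u(T+1)),\qquad \mathbf{F}(u)=-\sum_{n=1}^{T}F(n,u(n)),$$ let $D(\Psi+J)=\{u\in X:(\Psi+J)(u)<+\infty\}$, and let $\mathcal{E}=\Psi+J+\mathbf{F}$. Let $w\in X$ be a critical point of $\mathcal{E}$ in Szulkin's sense, that is, $w\in D(\Psi+J)$ and $$(\Psi+J)(v)-(\Psi+J)(w)+\langle\mathbf{F}'(w),v-w\rangle\ge 0\qquad\text{for all } v\in D(\Psi+J).$$ Then $w$ is a solution of the potential problem: $\|\Delta w\|_\infty<a$, $\partial j(w(0),w(T+1))\ne\emptyset$,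 $$-\Delta[\phi(\Delta w(n-1))]=\nabla_uF(n,w(n))\qquad(n=1,\dots,T),$$ where $\Delta[\phi(\Delta w(n-1))]=\phi(\Delta w(n))-\phi(\Delta w(n-1))$, and $$(\phi(\Delta w(0)),-\phi(\Delta w(T)))\in\partial j(w(0),w(T+1)).$$ -/

import Mathlib

noncomputable section

namespace DiscretePhiLaplacian

/-! ### Convex analysis for functions with values in `EReal` -/

section Convex

variable {V : Type*} [NormedAddCommGroup V] [InnerProductSpace ℝ V]

/-- Convexity of an extended-real-valued function: its epigraph in `V × ℝ` is convex. -/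
def ConvexEReal (f : V → EReal) : Prop :=
  Convex ℝ {p : V × ℝ | f p.1 ≤ (p.2 : EReal)}

/-- A function with values in `(-∞, +∞]` that is not identically `+∞`. -/
def ProperEReal (f : V → EReal) : Prop :=
  (∀ x, f x ≠ ⊥) ∧ ∃ x, f x ≠ ⊤

/-- The subdifferential of `f` at `x` in the sense of convex analysis:
all `p` with `f y ≥ f x + ⟨p, y - x⟩` for every `y`. For a proper `f` it is empty
at the points where `f = +∞`. -/
def subdifferential (f : V → EReal) (x : V) : Set V :=
  {p | ∀ y, f x + ((inner ℝ p (y - x) : ℝ) : EReal) ≤ f y}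

end Convex

/-- The effective domain of an extended-real-valued function. -/
def effDomain {X : Type*} (f : X → EReal) : Set X := {x | f x < ⊤}

/-- `w` is a critical point, in the sense of Szulkin, of the functional `Θ + G`, where
`Θ : X → (-∞, +∞]` is the convex part and `G : X → ℝ` is the `C¹` part:
`w ∈ D(Θ)` and `Θ v - Θ w + ⟨G' w, v - w⟩ ≥ 0` for all `v ∈ D(Θ)`. -/
def IsSzulkinCriticalPoint {X : Type*} [NormedAddCommGroup X] [NormedSpace ℝ X]
    (Θ : X → EReal) (G : X → ℝ) (w : X) : Prop :=
  w ∈ effDomain Θ ∧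
    ∀ v ∈ effDomain Θ, 0 ≤ Θ v - Θ w + ((fderiv ℝ G w (v - w) : ℝ) : EReal)

/-! ### Spaces and the difference operator -/

/-! In what follows `E` is a Hilbert space; the result is about `E = ℝ^N`, that is
`E = EuclideanSpace ℝ (Fin N)`. -/

section Problem

variable {E : Type*} [NormedAddCommGroup E]

/-- `E × E` with its usual (Euclidean) inner product. -/
abbrev VecPair (E : Type*) [NormedAddCommGroup E] : Type _ := WithLp 2 (E × E)

/-- The space `X_{T+2}` of functions `u : {0, …, T+1} → E`, with inner product
`(u|v) = ∑ₙ ⟨u n | v n⟩`. -/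
abbrev Traj (E : Type*) [NormedAddCommGroup E] (T : ℕ) : Type _ :=
  PiLp 2 (fun _ : Fin (T + 2) => E)

/-- The pair `(x, y)` in `E × E`. -/
def pair (x y : E) : VecPair E := WithLp.toLp 2 (x, y)

/-- The forward difference `Δu(n) = u(n+1) - u(n)` (`0 ≤ n < k`) of a finite sequence
`u(0), …, u(k)`. -/
def fdiff {k : ℕ} (u : Fin (k + 1) → E) (n : Fin k) : E :=
  u n.succ - u n.castSucc

/-- `‖Δu‖_∞`, the maximum of `|Δu(n)|` over `0 ≤ n ≤ T`. -/
def diffSup {T : ℕ} (u : Traj E T) : ℝ :=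
  Finset.univ.sup' Finset.univ_nonempty (fun n : Fin (T + 1) => ‖fdiff (fun i => u i) n‖)

/-- The boundary values `(u(0), u(T+1))`. -/
def bdry {T : ℕ} (u : Traj E T) : VecPair E := pair (u 0) (u (Fin.last (T + 1)))

/-- The position of `n + 1 ∈ {1, …, T}` inside `{0, …, T+1}`. The elements of `{1, …, T}`
are encoded by `Fin T`, with `n : Fin T` standing for the integer `n + 1`. -/
def interiorIdx {T : ℕ} (n : Fin T) : Fin (T + 2) := n.succ.castSucc

variable [InnerProductSpace ℝ E] [CompleteSpace E]

/-! ### Hypotheses on the data -/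

/-- The hypothesis on `φ : B_a → E` and `Φ : closure B_a → ℝ`. Both are given as functions on
`E`; the values of `φ` outside the open ball and of `Φ` outside the closed ball play no role. -/
structure HypPhi (a : ℝ) (φ : E → E) (Φ : E → ℝ) : Prop where
  homeo : IsHomeomorph ((Metric.ball (0 : E) a).domRestrict φ)
  map_zero : φ 0 = 0
  grad : ∀ x ∈ Metric.ball (0 : E) a, HasGradientAt Φ (φ x) x
  c1 : ContDiffOn ℝ 1 Φ (Metric.ball (0 : E) a)
  cont : ContinuousOn Φ (Metric.closedBall (0 : E) a)
  strictConvex : StrictConvexOn ℝ (Metric.closedBall (0 : E) a) Φ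
  pot_zero : Φ 0 = 0

/-- The hypothesis on `F : {1, …, T} × E → ℝ`. -/
structure HypF {T : ℕ} (F : Fin T → E → ℝ) : Prop where
  cont : ∀ n, Continuous (F n)
  diff : ∀ n, Differentiable ℝ (F n)
  cont_grad : ∀ n, Continuous (gradient (F n))
  map_zero : ∀ n, F n 0 = 0

/-- The hypothesis on `j : E × E → (-∞, +∞]`. -/
structure HypJ (j : VecPair E → EReal) : Prop where
  proper : ProperEReal j
  convex : ConvexEReal j
  lsc : LowerSemicontinuous j
  map_zero : j 0 = 0
  zero_mem : (0 : VecPair E) ∈ subdifferential j 0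

/-! ### The energy functional and the boundary value problem -/

open scoped Classical in
/-- `Ψ(u) = ∑ Φ(Δu(n))`, `0 ≤ n ≤ T`, if `‖Δu‖_∞ ≤ a`, and `+∞` otherwise. -/
def Psi {T : ℕ} (a : ℝ) (Φ : E → ℝ) (u : Traj E T) : EReal :=
  if diffSup u ≤ a then ((∑ n : Fin (T + 1), Φ (fdiff (fun i => u i) n) : ℝ) : EReal) else ⊤

/-- `J(u) = j(u(0), u(T+1))`. -/
def bdryFunctional {T : ℕ} (j : VecPair E → EReal) (u : Traj E T) : EReal := j (bdry u)

/-- `𝐅(u) = -∑ F(n, u(n))`, `1 ≤ n ≤ T`. -/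
def smoothPart {T : ℕ} (F : Fin T → E → ℝ) (u : Traj E T) : ℝ :=
  -∑ n : Fin T, F n (u (interiorIdx n))

/-- `w` is a critical point of the energy functional `ℰ = (Ψ + J) + 𝐅`. -/
def IsEnergyCriticalPoint {T : ℕ} (a : ℝ) (Φ : E → ℝ) (j : VecPair E → EReal)
    (F : Fin T → E → ℝ) (w : Traj E T) : Prop :=
  IsSzulkinCriticalPoint (fun u => Psi a Φ u + bdryFunctional j u) (smoothPart F) w

/-- `u` is a solution of the problem
`-Δ[φ(Δu(n-1))] = ∇_u F(n, u(n))` for `1 ≤ n ≤ T`,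
`(φ(Δu(0)), -φ(Δu(T))) ∈ ∂j(u(0), u(T+1))`;
this includes `‖Δu‖_∞ < a` and `(u(0), u(T+1)) ∈ D(∂j)`. -/
structure IsSolution {T : ℕ} (a : ℝ) (φ : E → E) (j : VecPair E → EReal)
    (F : Fin T → E → ℝ) (u : Traj E T) : Prop where
  diff_lt : diffSup u < a
  mem_dom : (subdifferential j (bdry u)).Nonempty
  eqn : ∀ n : Fin T,
    -fdiff (fun k : Fin (T + 1) => φ (fdiff (fun i => u i) k)) n
      = gradient (F n) (u (interiorIdx n))
  bc : pair (φ (fdiff (fun i => u i) 0)) (-φ (fdiff (fun i => u i) (Fin.last T)))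
    ∈ subdifferential j (bdry u)

end Problem

end DiscretePhiLaplacian

end

/-! The critical point inequality is tested along segments `w + t • h`, where convexity bounds the
variation of `j` by `t * (c - r)`. The crux is the strict bound `diffSup w < a`: as `Φ` is finite on
the sphere, finite energy gives only `≤ a`. Contract `w` to `s • w` with `s < 1`, keeping all
differences inside the ball. The gradient inequality then bounds the sum of `⟨φ(sΔw(n)), Δw(n)⟩`
uniformly in `s`; the terms are nonnegative by monotonicity of `φ`, so each is bounded. Monotonicity
also turns this radial bound into a bound on `φ(sΔw(n))`, and the inverse homeomorphism sends
bounded sets into compact subsets of the open ball (`norm_lt_of_inner_le`). Now every direction `h`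
is admissible for small `t`, so one can divide by `t`, let `t → 0⁺` and sum by parts. Directions
supported at one interior point give the equation; directions with arbitrary boundary values give
the subgradient inclusion. -/

namespace DiscretePhiLaplacian

/-! ### Monotonicity of `φ` and its blow-up at the sphere -/

section Gradient

variable {E : Type*} [NormedAddCommGroup E] [InnerProductSpace ℝ E] [CompleteSpace E]

/-- The gradient inequality for a convex function. -/
theorem gradient_inequality {s : Set E} {f : E → ℝ} (hf : ConvexOn ℝ s f) {x y g : E}
    (hx : x ∈ s) (hy : y ∈ s) (hg : HasGradientAt f g y) :
    f y + inner ℝ g (x - y) ≤ f x := by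
  have hd : HasDerivAt (fun t : ℝ => f (y + t • (x - y))) (inner ℝ g (x - y)) 0 := by
    have hline : HasDerivAt (fun t : ℝ => y + t • (x - y)) (x - y) 0 := by
      simpa using ((hasDerivAt_id (0 : ℝ)).smul_const (x - y)).const_add y
    have hfd : HasFDerivAt f (InnerProductSpace.toDual ℝ E g) (y + (0 : ℝ) • (x - y)) := by
      simpa using hg.hasFDerivAt
    simpa [Function.comp_def] using hfd.comp_hasDerivAt (0 : ℝ) hline
  have ht := hd.tendsto_slope_zero_right
  have hle : inner ℝ g (x - y) ≤ f x - f y := by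
    refine le_of_tendsto ht ?_
    filter_upwards [Ioo_mem_nhdsGT (zero_lt_one (α := ℝ))] with t ht
    have hc := hf.2 hy hx (sub_nonneg.2 ht.2.le) ht.1.le (by ring)
    have he : y + t • (x - y) = (1 - t) • y + t • x := by module
    simp only [zero_add, zero_smul, add_zero, smul_eq_mul] at hc ⊢
    rw [he, inv_mul_le_iff₀ ht.1]
    linarith
  linarith

namespace HypPhi

variable {a : ℝ} {φ : E → E} {Φ : E → ℝ}

theorem potential_ge (hΦ : HypPhi a φ Φ) {x y : E} (hx : x ∈ Metric.closedBall (0 : E) a)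
    (hy : y ∈ Metric.ball (0 : E) a) : Φ y + inner ℝ (φ y) (x - y) ≤ Φ x :=
  gradient_inequality hΦ.strictConvex.convexOn hx (Metric.ball_subset_closedBall hy)
    (hΦ.grad y hy)

/-- Add the gradient inequalities based at `x` and at `y`. -/
theorem monotone (hΦ : HypPhi a φ Φ) {x y : E} (hx : x ∈ Metric.ball (0 : E) a)
    (hy : y ∈ Metric.ball (0 : E) a) : inner ℝ (φ y) (x - y) ≤ inner ℝ (φ x) (x - y) := by
  have h₁ := hΦ.potential_ge (Metric.ball_subset_closedBall hx) hy
  have h₂ := hΦ.potential_ge (Metric.ball_subset_closedBall hy) hx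
  rw [← neg_sub x y, inner_neg_right] at h₂
  linarith

theorem inner_nonneg (hΦ : HypPhi a φ Φ) (ha : 0 < a) {x : E}
    (hx : x ∈ Metric.ball (0 : E) a) : 0 ≤ inner ℝ (φ x) x := by
  simpa [hΦ.map_zero] using hΦ.monotone hx (Metric.mem_ball_self ha)

/-- A set on which `φ` is bounded stays away from the boundary of the ball. -/
theorem exists_norm_le [ProperSpace E] (hΦ : HypPhi a φ Φ) (C : ℝ) :
    ∃ m < a, ∀ x ∈ Metric.ball (0 : E) a, ‖φ x‖ ≤ C → ‖x‖ ≤ m := by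
  let e := hΦ.homeo.homeomorph
  have hK : IsCompact (e.symm '' Metric.closedBall (0 : E) C) :=
    (isCompact_closedBall _ _).image e.symm.continuous
  have hmem : ∀ x (hx : x ∈ Metric.ball (0 : E) a), ‖φ x‖ ≤ C →
      (⟨x, hx⟩ : Metric.ball (0 : E) a) ∈ e.symm '' Metric.closedBall (0 : E) C := by
    intro x hx hC
    refine ⟨φ x, by simpa using hC, ?_⟩
    exact e.symm_apply_apply ⟨x, hx⟩
  rcases (e.symm '' Metric.closedBall (0 : E) C).eq_empty_or_nonempty with hemp | hne
  -- This case occurs only for `C < 0`; any number below `a` would do.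
  · refine ⟨a - 1, by linarith, fun x hx hC => ?_⟩
    have := hmem x hx hC
    rw [hemp] at this
    exact this.elim
  · obtain ⟨z, -, hz⟩ := hK.exists_isMaxOn hne
      (continuous_norm.comp continuous_subtype_val).continuousOn
    refine ⟨‖(z : E)‖, mem_ball_zero_iff.1 z.2, fun x hx hC => ?_⟩
    exact hz (hmem x hx hC)

/-- Along a radius, `⟨φ (s x), x⟩` controls `‖φ (s x)‖`. -/
theorem exists_norm_le_of_inner_le (hΦ : HypPhi a φ Φ) (ha : 0 < a) :
    ∃ r > 0, ∀ x ∈ Metric.ball (0 : E) a, r * ‖φ x‖ ≤ inner ℝ (φ x) x + (r + a) := by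
  have hcont : ContinuousAt φ 0 := by
    have h := hΦ.homeo.continuous
    have h' : ContinuousOn φ (Metric.ball (0 : E) a) := continuousOn_iff_continuous_domRestrict.2 h
    exact h'.continuousAt (Metric.ball_mem_nhds 0 ha)
  obtain ⟨δ, hδ, hφδ⟩ := Metric.continuousAt_iff.1 hcont 1 one_pos
  refine ⟨min δ a / 2, by positivity, fun x hx => ?_⟩
  set r := min δ a / 2 with hr
  have hr0 : 0 < r := by positivity
  have hrδ : r < δ := by have := min_le_left δ a; have := lt_min hδ ha; linarith
  have hra : r < a := by have := min_le_right δ a; have := lt_min hδ ha; linarith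
  have hxa : ‖x‖ < a := by simpa using hx
  rcases eq_or_ne (φ x) 0 with h0 | h0
  · simp only [h0, norm_zero, mul_zero, inner_zero_left]; positivity
  have hn : ‖φ x‖ ≠ 0 := norm_ne_zero_iff.2 h0
  -- Monotonicity is tested against the vector of length `r` in the direction of `φ x`: it pairs
  -- with `φ x` to `r * ‖φ x‖`, and `r < δ` keeps `φ y` bounded by 1.
  let y : E := (r / ‖φ x‖) • φ x
  have hyn : ‖y‖ = r := by
    rw [norm_smul, Real.norm_of_nonneg (by positivity)]
    field_simp
  have hy : y ∈ Metric.ball (0 : E) a := by simpa [hyn] using hra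
  have hφy : ‖φ y‖ ≤ 1 := by
    have := hφδ (x := y) (by simpa [hyn] using hrδ)
    rw [hΦ.map_zero, dist_zero_right] at this
    exact this.le
  have hm := hΦ.monotone hx hy
  have hin : inner ℝ (φ x) y = r * ‖φ x‖ := by
    simp only [y, inner_smul_right, real_inner_self_eq_norm_sq]
    field_simp
  have hlow : -(r + a) ≤ inner ℝ (φ y) (x - y) := by
    have h₁ := neg_le_of_abs_le (abs_real_inner_le_norm (φ y) (x - y))
    have h₂ : ‖φ y‖ * ‖x - y‖ ≤ 1 * (r + a) := by
      gcongr
      calc ‖x - y‖ ≤ ‖x‖ + ‖y‖ := norm_sub_le _ _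
        _ ≤ r + a := by rw [hyn]; linarith
    linarith
  rw [inner_sub_right (φ x), hin] at hm
  linarith

/-- The radial derivative of the potential is unbounded near the sphere of radius `a`. -/
theorem norm_lt_of_inner_le [ProperSpace E] (hΦ : HypPhi a φ Φ) (ha : 0 < a) {x : E} {C : ℝ}
    (hx : ‖x‖ ≤ a) (hC : ∀ s ∈ Set.Ioo (0 : ℝ) 1, inner ℝ (φ (s • x)) x ≤ C) : ‖x‖ < a := by
  obtain ⟨r, hr, hbd⟩ := hΦ.exists_norm_le_of_inner_le ha
  -- The bound on `‖φ (s • x)‖` given by `hbd`; `|C|` replaces `C`, which may be negative, to absorb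
  -- the factor `s < 1`.
  obtain ⟨m, hm, hle⟩ := hΦ.exists_norm_le ((|C| + (r + a)) / r)
  refine lt_of_le_of_lt ?_ hm
  have hs : ∀ s ∈ Set.Ioo (0 : ℝ) 1, s * ‖x‖ ≤ m := by
    intro s hs
    have hball : s • x ∈ Metric.ball (0 : E) a := by
      rw [mem_ball_zero_iff, norm_smul, Real.norm_eq_abs, abs_of_pos hs.1]
      nlinarith [hs.1, hs.2, norm_nonneg x]
    have h := hle _ hball <| by
      rw [le_div_iff₀ hr, mul_comm]
      refine (hbd _ hball).trans ?_
      have : inner ℝ (φ (s • x)) (s • x) ≤ |C| := by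
        rw [inner_smul_right]
        calc s * inner ℝ (φ (s • x)) x ≤ s * |C| :=
              mul_le_mul_of_nonneg_left ((hC s hs).trans (le_abs_self C)) hs.1.le
          _ ≤ 1 * |C| := mul_le_mul_of_nonneg_right hs.2.le (abs_nonneg C)
          _ = |C| := one_mul _
      linarith
    rwa [norm_smul, Real.norm_eq_abs, abs_of_pos hs.1] at h
  have hlim : Filter.Tendsto (fun s : ℝ => s * ‖x‖) (nhdsWithin 1 (Set.Iio 1))
      (nhds (1 * ‖x‖)) :=
    ((continuous_id.mul continuous_const).tendsto (1 : ℝ)).mono_left nhdsWithin_le_nhds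
  rw [one_mul] at hlim
  refine le_of_tendsto hlim ?_
  filter_upwards [Ioo_mem_nhdsLT (zero_lt_one (α := ℝ))] with s h using hs s h

end HypPhi

end Gradient

/-! ### Algebra and differentiation of the functionals -/

section Functionals

variable {E : Type*} [NormedAddCommGroup E]

theorem diffSup_le_iff {T : ℕ} {u : Traj E T} {c : ℝ} :
    diffSup u ≤ c ↔ ∀ n, ‖fdiff (fun i => u i) n‖ ≤ c := by
  simp [diffSup]

theorem diffSup_lt_iff {T : ℕ} {u : Traj E T} {c : ℝ} :
    diffSup u < c ↔ ∀ n, ‖fdiff (fun i => u i) n‖ < c := by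
  simp [diffSup]

variable [InnerProductSpace ℝ E]

theorem fdiff_add_smul {T : ℕ} (u h : Traj E T) (t : ℝ) (n : Fin (T + 1)) :
    fdiff (fun i => (u + t • h) i) n
      = fdiff (fun i => u i) n + t • fdiff (fun i => h i) n := by
  simp only [fdiff, PiLp.add_apply, PiLp.smul_apply]
  module

theorem bdry_add_smul {T : ℕ} (u h : Traj E T) (t : ℝ) :
    bdry (u + t • h) = bdry u + t • bdry h := rfl

/-- Summation by parts. -/
theorem sum_inner_fdiff {T : ℕ} (c : Fin (T + 1) → E) (h : Fin (T + 2) → E) :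
    ∑ n, inner ℝ (c n) (fdiff h n)
      = inner ℝ (c (Fin.last T)) (h (Fin.last (T + 1))) - inner ℝ (c 0) (h 0)
        - ∑ n : Fin T, inner ℝ (fdiff c n) (h (interiorIdx n)) := by
  simp only [fdiff, inner_sub_right, inner_sub_left, Finset.sum_sub_distrib]
  rw [Fin.sum_univ_castSucc (fun n : Fin (T + 1) => inner ℝ (c n) (h n.succ)),
    Fin.sum_univ_succ (fun n : Fin (T + 1) => inner ℝ (c n) (h n.castSucc))]
  simp only [interiorIdx, Fin.succ_last, Fin.castSucc_zero, Fin.succ_castSucc]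
  ring

/-- Real majorants `r`, `c` make this convexity of the epigraph, free of `EReal` arithmetic. -/
theorem ConvexEReal.add_smul_le {f : E → EReal} (hf : ConvexEReal f) {x y : E} {r c t : ℝ}
    (hx : f x ≤ r) (hy : f (x + y) ≤ c) (h₀ : 0 ≤ t) (h₁ : t ≤ 1) :
    f (x + t • y) ≤ ((r + t * (c - r) : ℝ) : EReal) := by
  have h := hf (x := (x, r)) hx (y := (x + y, c)) hy (sub_nonneg.2 h₁) h₀ (by ring)
  simp only [Set.mem_ofPred_eq, Prod.smul_mk, Prod.mk_add_mk, smul_eq_mul] at h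
  convert h using 2
  · module
  · ring_nf

variable [CompleteSpace E]

theorem HypF.fderiv_smoothPart {T : ℕ} {F : Fin T → E → ℝ} (hF : HypF F) (w h : Traj E T) :
    fderiv ℝ (smoothPart F) w h
      = -∑ n, inner ℝ (gradient (F n) (w (interiorIdx n))) (h (interiorIdx n)) := by
  have hn : ∀ n, HasFDerivAt (fun u : Traj E T => F n (u (interiorIdx n)))
      ((InnerProductSpace.toDual ℝ E (gradient (F n) (w (interiorIdx n)))).comp
        (PiLp.proj 2 (fun _ : Fin (T + 2) => E) (interiorIdx n) : Traj E T →L[ℝ] E)) w := by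
    intro n
    have hg := ((hF.diff n) (w (interiorIdx n))).hasGradientAt.hasFDerivAt
    exact HasFDerivAt.comp (g := F n) w hg
      (PiLp.proj 2 (fun _ : Fin (T + 2) => E) (interiorIdx n) : Traj E T →L[ℝ] E).hasFDerivAt
  have hs := (HasFDerivAt.fun_sum (u := Finset.univ) (fun n _ => hn n)).neg
  have he : fderiv ℝ (smoothPart F) w = _ := HasFDerivAt.fderiv hs
  rw [he]
  simp

end Functionals

/-! ### From the critical point inequality to the boundary value problem -/

section CriticalPoint

variable {E : Type*} [NormedAddCommGroup E] [InnerProductSpace ℝ E]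
variable {T : ℕ} {a : ℝ} {φ : E → E} {Φ : E → ℝ} {F : Fin T → E → ℝ}
  {j : VecPair E → EReal} {w : Traj E T}

namespace IsEnergyCriticalPoint

theorem diffSup_le (hj : HypJ j) (hw : IsEnergyCriticalPoint a Φ j F w) : diffSup w ≤ a := by
  by_contra h
  have h₁ : Psi a Φ w + j (bdry w) < ⊤ := hw.1
  -- Needed because `⊤ + ⊥ = ⊥` in `EReal`.
  have hbot : j (bdry w) ≠ ⊥ := hj.proper.1 _
  rw [Psi, if_neg h, EReal.top_add_of_ne_bot hbot] at h₁
  exact lt_irrefl _ h₁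

theorem exists_coe_eq (hj : HypJ j) (hw : IsEnergyCriticalPoint a Φ j F w) :
    ∃ r : ℝ, j (bdry w) = r := by
  have h₁ : Psi a Φ w + j (bdry w) < ⊤ := hw.1
  have hbot : j (bdry w) ≠ ⊥ := hj.proper.1 _
  rw [Psi, if_pos (hw.diffSup_le hj)] at h₁
  refine ⟨(j (bdry w)).toReal, (EReal.coe_toReal ?_ hbot).symm⟩
  intro htop
  rw [htop, EReal.coe_add_top] at h₁
  exact lt_irrefl _ h₁

/-- The inequality defining critical points, tested at `w + t h` and written in `ℝ`. -/
theorem inequality (hj : HypJ j) (hw : IsEnergyCriticalPoint a Φ j F w) {r c t : ℝ}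
    (hr : j (bdry w) = r) {h : Traj E T} (hc : j (bdry w + bdry h) ≤ c)
    (h₀ : 0 ≤ t) (h₁ : t ≤ 1)
    (hle : ∀ n, ‖fdiff (fun i => w i) n + t • fdiff (fun i => h i) n‖ ≤ a) :
    0 ≤ ∑ n, Φ (fdiff (fun i => w i) n + t • fdiff (fun i => h i) n)
      - ∑ n, Φ (fdiff (fun i => w i) n) + t * (c - r + fderiv ℝ (smoothPart F) w h) := by
  have hsup : diffSup (w + t • h) ≤ a := diffSup_le_iff.2 fun n => by
    rw [fdiff_add_smul]; exact hle n
  have hjv : j (bdry (w + t • h)) ≤ ((r + t * (c - r) : ℝ) : EReal) := by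
    rw [bdry_add_smul]; exact hj.convex.add_smul_le hr.le hc h₀ h₁
  obtain ⟨q, hq⟩ : ∃ q : ℝ, j (bdry (w + t • h)) = q :=
    ⟨_, (EReal.coe_toReal (ne_top_of_le_ne_top (EReal.coe_ne_top _) hjv)
      (hj.proper.1 _)).symm⟩
  have hv := hw.2 (w + t • h) (by
    simp only [effDomain, Set.mem_ofPred_eq, Psi, if_pos hsup, bdryFunctional, hq]
    exact_mod_cast EReal.coe_lt_top _)
  simp only [Psi, if_pos hsup, if_pos (hw.diffSup_le hj), bdryFunctional, hq, hr,
    add_sub_cancel_left, map_smul, smul_eq_mul, fdiff_add_smul] at hv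
  rw [hq] at hjv
  have hq' : q ≤ r + t * (c - r) := EReal.coe_le_coe_iff.1 hjv
  norm_cast at hv
  linarith

variable [CompleteSpace E]

/-- A critical point satisfies `‖Δw‖_∞ < a`. -/
theorem diffSup_lt [ProperSpace E] (ha : 0 < a) (hΦ : HypPhi a φ Φ) (hj : HypJ j)
    (hw : IsEnergyCriticalPoint a Φ j F w) : diffSup w < a := by
  obtain ⟨r, hr⟩ := hw.exists_coe_eq hj
  have hle := diffSup_le_iff.1 (hw.diffSup_le hj)
  have hball : ∀ s ∈ Set.Ioo (0 : ℝ) 1, ∀ n,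
      s • fdiff (fun i => w i) n ∈ Metric.ball (0 : E) a := by
    intro s hs n
    rw [mem_ball_zero_iff, norm_smul, Real.norm_eq_abs, abs_of_pos hs.1]
    nlinarith [hs.1, hs.2, hle n, norm_nonneg (fdiff (fun i => w i) n)]
  refine diffSup_lt_iff.2 fun k => hΦ.norm_lt_of_inner_le ha (hle k)
    -- Here `0` is the value of `j` at the origin, the endpoint of the contraction; the constant
    -- does not depend on `s`.
    (C := 0 - r + fderiv ℝ (smoothPart F) w (-w)) fun s hs => ?_
  have hneg : ∀ n, fdiff (fun i => w i) n + (1 - s) • fdiff (fun i => (-w) i) n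
      = s • fdiff (fun i => w i) n := by
    intro n
    simp only [fdiff, PiLp.neg_apply]
    module
  have h := hw.inequality hj hr (h := -w) (c := 0) (t := 1 - s)
    (by
      have : bdry w + bdry (-w) = 0 := by
        have := bdry_add_smul w (-w) 1
        rw [one_smul, one_smul, add_neg_cancel] at this
        exact this.symm
      rw [this, hj.map_zero]; rfl)
    (by linarith [hs.2]) (by linarith [hs.1])
    (fun n => by rw [hneg]; exact (mem_ball_zero_iff.1 (hball s hs n)).le)
  simp only [hneg] at h
  have hnn : ∀ n, 0 ≤ inner ℝ (φ (s • fdiff (fun i => w i) n)) (fdiff (fun i => w i) n) := by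
    intro n
    have := hΦ.inner_nonneg ha (hball s hs n)
    rw [inner_smul_right] at this
    exact nonneg_of_mul_nonneg_right this hs.1
  have hgrad : ∀ n, Φ (s • fdiff (fun i => w i) n)
      + (1 - s) * inner ℝ (φ (s • fdiff (fun i => w i) n)) (fdiff (fun i => w i) n)
        ≤ Φ (fdiff (fun i => w i) n) := by
    intro n
    have := hΦ.potential_ge (mem_closedBall_zero_iff.2 (hle n)) (hball s hs n)
    have he : fdiff (fun i => w i) n - s • fdiff (fun i => w i) n
        = (1 - s) • fdiff (fun i => w i) n := by module
    rwa [he, inner_smul_right] at this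
  have hsum := Finset.sum_le_sum fun n (_ : n ∈ Finset.univ) => hgrad n
  rw [Finset.sum_add_distrib, ← Finset.mul_sum] at hsum
  refine (Finset.single_le_sum (f := fun n => inner ℝ (φ (s • fdiff (fun i => w i) n))
    (fdiff (fun i => w i) n)) (fun n _ => hnn n) (Finset.mem_univ k)).trans ?_
  refine le_of_mul_le_mul_left ?_ (sub_pos.2 hs.2)
  linarith

/-- The variational inequality obtained by differentiating the energy along a segment. -/
theorem variational_inequality (hΦ : HypPhi a φ Φ) (hj : HypJ j)
    (hw : IsEnergyCriticalPoint a Φ j F w) (hlt : diffSup w < a) {r c : ℝ}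
    (hr : j (bdry w) = r) {h : Traj E T} (hc : j (bdry w + bdry h) ≤ c) :
    0 ≤ ∑ n, inner ℝ (φ (fdiff (fun i => w i) n)) (fdiff (fun i => h i) n)
      + (c - r + fderiv ℝ (smoothPart F) w h) := by
  have hlt' := diffSup_lt_iff.1 hlt
  have hline : ∀ n, HasDerivAt
      (fun t : ℝ => fdiff (fun i => w i) n + t • fdiff (fun i => h i) n)
      (fdiff (fun i => h i) n) 0 := fun n => by
    simpa using ((hasDerivAt_id (0 : ℝ)).smul_const (fdiff (fun i => h i) n)).const_add
      (fdiff (fun i => w i) n)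
  have hd : ∀ n, HasDerivAt
      (fun t : ℝ => Φ (fdiff (fun i => w i) n + t • fdiff (fun i => h i) n))
      (inner ℝ (φ (fdiff (fun i => w i) n)) (fdiff (fun i => h i) n)) 0 := by
    intro n
    have hfd : HasFDerivAt Φ (InnerProductSpace.toDual ℝ E (φ (fdiff (fun i => w i) n)))
        (fdiff (fun i => w i) n + (0 : ℝ) • fdiff (fun i => h i) n) := by
      simpa using (hΦ.grad _ (mem_ball_zero_iff.2 (hlt' n))).hasFDerivAt
    simpa [Function.comp_def] using hfd.comp_hasDerivAt (0 : ℝ) (hline n)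
  have hsum := (HasDerivAt.fun_sum (u := Finset.univ) fun n _ => hd n).tendsto_slope_zero_right
  have hsmall : ∀ᶠ t : ℝ in nhdsWithin 0 (Set.Ioi 0),
      ∀ n, ‖fdiff (fun i => w i) n + t • fdiff (fun i => h i) n‖ ≤ a := by
    -- The strict bound at `t = 0` persists for small `t`, separately for each of the finitely many
    -- `n`.
    refine Filter.eventually_all.2 fun n => ?_
    have hcont := (hline n).continuousAt.norm
    have := hcont.eventually_lt (continuousAt_const (y := a)) (by simpa using hlt' n)
    exact (this.filter_mono nhdsWithin_le_nhds).mono fun t ht => ht.le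
  refine ge_of_tendsto (hsum.add_const _) ?_
  filter_upwards [hsmall, Ioo_mem_nhdsGT (zero_lt_one (α := ℝ))] with t hta ht
  have hineq := hw.inequality hj hr hc ht.1.le ht.2.le hta
  simp only [zero_add, zero_smul, add_zero, smul_eq_mul]
  have hdiv := mul_nonneg (inv_nonneg.2 ht.1.le) hineq
  rwa [mul_add, inv_mul_cancel_left₀ ht.1.ne'] at hdiv

/-- The variational inequality after summation by parts. -/
theorem variational_inequality_by_parts (hΦ : HypPhi a φ Φ) (hF : HypF F) (hj : HypJ j)
    (hw : IsEnergyCriticalPoint a Φ j F w) (hlt : diffSup w < a) {r c : ℝ}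
    (hr : j (bdry w) = r) {h : Traj E T} (hc : j (bdry w + bdry h) ≤ c) :
    0 ≤ inner ℝ (φ (fdiff (fun i => w i) (Fin.last T))) (h (Fin.last (T + 1)))
      - inner ℝ (φ (fdiff (fun i => w i) 0)) (h 0)
      - ∑ n : Fin T, inner ℝ (fdiff (fun k : Fin (T + 1) => φ (fdiff (fun i => w i) k)) n
          + gradient (F n) (w (interiorIdx n))) (h (interiorIdx n)) + (c - r) := by
  have hv := hw.variational_inequality hΦ hj hlt hr hc
  rw [sum_inner_fdiff (fun n => φ (fdiff (fun i => w i) n)), hF.fderiv_smoothPart] at hv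
  simp only [inner_add_left, Finset.sum_add_distrib]
  linarith

theorem euler_equation (hΦ : HypPhi a φ Φ) (hF : HypF F) (hj : HypJ j)
    (hw : IsEnergyCriticalPoint a Φ j F w) (hlt : diffSup w < a) (n : Fin T) :
    -fdiff (fun k : Fin (T + 1) => φ (fdiff (fun i => w i) k)) n
      = gradient (F n) (w (interiorIdx n)) := by
  obtain ⟨r, hr⟩ := hw.exists_coe_eq hj
  set g := fdiff (fun k : Fin (T + 1) => φ (fdiff (fun i => w i) k)) n
    + gradient (F n) (w (interiorIdx n)) with hg
  -- With the residual `g` as test value and the boundary values unchanged, the inequality reads `0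
  -- ≤ -‖g‖²`.
  let h : Traj E T := WithLp.toLp 2 (Pi.single (interiorIdx n) g)
  have h_zero : h 0 = 0 :=
    Pi.single_eq_of_ne (M := fun _ => E)
      (by simp [interiorIdx, Fin.ext_iff] : (0 : Fin (T + 2)) ≠ interiorIdx n) g
  have h_last : h (Fin.last (T + 1)) = 0 :=
    Pi.single_eq_of_ne (M := fun _ => E) (by simp [interiorIdx, Fin.ext_iff]; omega) _
  have h_bdry : bdry h = 0 := by
    rw [bdry, h_zero, h_last]; rfl
  have hv := hw.variational_inequality_by_parts hΦ hF hj hlt hr (h := h) (c := r)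
    (by rw [h_bdry, add_zero, hr])
  rw [h_zero, h_last, Finset.sum_eq_single n] at hv
  · have h_self : h (interiorIdx n) = g := Pi.single_eq_same _ _
    rw [h_self, ← hg, real_inner_self_eq_norm_sq] at hv
    simp only [inner_zero_right, sub_self, zero_sub, add_zero] at hv
    have hg0 : ‖g‖ = 0 := by nlinarith [sq_nonneg ‖g‖, norm_nonneg g]
    exact neg_eq_of_add_eq_zero_right (hg ▸ norm_eq_zero.1 hg0)
  · intro m _ hm
    have : h (interiorIdx m) = 0 :=
      Pi.single_eq_of_ne (by simpa [interiorIdx] using hm) _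
    rw [this, inner_zero_right]
  · simp

theorem boundary_condition (hΦ : HypPhi a φ Φ) (hF : HypF F) (hj : HypJ j)
    (hw : IsEnergyCriticalPoint a Φ j F w) (hlt : diffSup w < a) :
    pair (φ (fdiff (fun i => w i) 0)) (-φ (fdiff (fun i => w i) (Fin.last T)))
      ∈ subdifferential j (bdry w) := by
  obtain ⟨r, hr⟩ := hw.exists_coe_eq hj
  intro y
  rcases eq_or_ne (j y) ⊤ with htop | htop
  · rw [htop]; exact le_top
  obtain ⟨c, hc⟩ : ∃ c : ℝ, j y = c :=
    ⟨_, (EReal.coe_toReal htop (hj.proper.1 _)).symm⟩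
  -- Only the two end values matter: the Euler equation removes the interior sum, so the interior
  -- values are arbitrary.
  let h : Traj E T := WithLp.toLp 2
    (Fin.cons (y - bdry w).fst (fun _ => (y - bdry w).snd))
  have h_bdry : bdry w + bdry h = y := by
    have : bdry h = y - bdry w := rfl
    rw [this, add_sub_cancel]
  have hv := hw.variational_inequality_by_parts hΦ hF hj hlt hr (h := h) (c := c)
    (by rw [h_bdry, hc])
  have h_eq : ∀ n : Fin T, fdiff (fun k : Fin (T + 1) => φ (fdiff (fun i => w i) k)) n
      + gradient (F n) (w (interiorIdx n)) = 0 := fun n => by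
    rw [← hw.euler_equation hΦ hF hj hlt n, add_neg_cancel]
  have h_zero : h 0 = (y - bdry w).fst := rfl
  have h_last : h (Fin.last (T + 1)) = (y - bdry w).snd := rfl
  simp only [h_eq, inner_zero_left, Finset.sum_const_zero, h_zero, h_last] at hv
  rw [hr, hc, ← EReal.coe_add, EReal.coe_le_coe_iff, WithLp.prod_inner_apply]
  simp only [pair, inner_neg_left]
  change 0 ≤ inner ℝ _ (y - bdry w).ofLp.2 - inner ℝ _ (y - bdry w).ofLp.1 - 0 + (c - r) at hv
  linarith

end IsEnergyCriticalPoint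

end CriticalPoint

end DiscretePhiLaplacian

theorem theorem4p2 {N T : ℕ} {a : ℝ} (ha : 0 < a)
    (φ : EuclideanSpace ℝ (Fin N) → EuclideanSpace ℝ (Fin N))
    (Φ : EuclideanSpace ℝ (Fin N) → ℝ)
    (hΦ : DiscretePhiLaplacian.HypPhi a φ Φ)
    (F : Fin T → EuclideanSpace ℝ (Fin N) → ℝ)
    (hF : DiscretePhiLaplacian.HypF F)
    (j : DiscretePhiLaplacian.VecPair (EuclideanSpace ℝ (Fin N)) → EReal)
    (hj : DiscretePhiLaplacian.HypJ j)
    (w : DiscretePhiLaplacian.Traj (EuclideanSpace ℝ (Fin N)) T)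
    (hw : DiscretePhiLaplacian.IsEnergyCriticalPoint a Φ j F w) :
    DiscretePhiLaplacian.IsSolution a φ j F w := by
  have hlt := hw.diffSup_lt ha hΦ hj
  have hbc := hw.boundary_condition hΦ hF hj hlt
  exact ⟨hlt, ⟨_, hbc⟩, hw.euler_equation hΦ hF hj hlt, hbc⟩
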